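/- **Conventions.** A hypergraph $H=(V(H),E(H))$ has a finite vertex set, non-empty edges $e\subseteq V(H)$, and every vertex lies in some edge. A rooted forest is a finite directed graph (arcs from parents to children) in which every vertex has at most one parent and there is no directed cycle; a rooted tree is a rooted forest with exactly one root; every vertex is an ancestor and a descendant of itself. An elimination forest of $H$ is a rooted forest $F$ with vertex set $V(H)$ such that any two vertices lying in a common edge of $H$ are in the ancestor relation of $F$. A tree decomposition $\mathbf t=(T,\mathrm{bag})$ of $H$ is a rooted tree $T$ with bags $\mathrm{bag}(x)\subseteq V(H)$ such that every edge of $H$ is contained in some bag and, for each $v\in V(H)$, the nodes whose bags contain $v$ induce a connected subgraph of $T$. The margin of a node is its bag minus the bag of its parent (the whole bag for the root); $\mathrm{mn}(u)$ is the unique node with $u$ in its margin. For an elimination forest $F$ of $H$, the stain of $u\in V(H)$ is the set consisting of $\mathrm{mn}(u)$ and all nodes on the paths in $T$ from $\mathrm{mn}(u)$ to $\mathrm{mn}(v)$, $v$ a child of $u$ in $F$. The conflict graph $\mathsf{CG}(\mathbf t,F)$ has vertex set $V(H)$, two distinct vertices being adjacent iff their stains intersect. The signature $\tau_{td}$ has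 unary symbols $\mathit{Vertex},\mathit{Edge},\mathit{Node}$ and binary symbols $\mathit{Bag},\mathit{Adjacent},\mathit{Descendant}$; $\tau_{ef}$ has unary symbols $\mathit{Vertex},\mathit{Edge}$ and binary symbols $\mathit{Child},\mathit{Adjacent}$. The structure $M(H,\mathbf t)$ over $\tau_{td}$ has as universe the disjoint union of $V(H)$, $E(H)$ and $V(T)$, the unary symbols denote these three sets, and the binary ones denote membership of a vertex in the bag of a node, membership of a vertex in an edge, and the (reflexive) relation "$y$ is a descendant of $x$" of $T$. For a structure $M$ over $\tau_{ef}$, $H(M)$ is the hypergraph with vertex set $\mathit{Vertex}$ and incidence relation $\mathit{Adjacent}\subseteq\mathit{Vertex}\times\mathit{Edge}$, and $F(M)$ is the directed graph with vertex set $\mathit{Vertex}$ and arcs $\mathit{Child}$. An MSO transduction is a non-empty finite sequence of elementary transductions with matching signatures: colouring (adds one arbitrary unary predicate), $k$-copying, MSO interpretation, filtering by an MSO sentence, universe restriction by an MSO formula with one free element variable. It maps a structure to the set of its possible outputs. Its size is the sum of the sizes of its elementary transductions: $1$ for colouring, $k$ for $k$-copying, and the total number of symbols of the formulas for the others. **Lemma.**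 There is an algorithm that, given an integer $q>0$, outputs an MSO transduction $\mathbf{Tr}_q$ of size $O(q)$ with input signature $\tau_{td}$ and output signature $\tau_{ef}$, such that for every $q>0$, every hypergraph $H$ and every tree decomposition $\mathbf t$ of $H$: 1. every $M^*\in\mathbf{Tr}_q(M(H,\mathbf t))$ satisfies $H(M^*)=H$, and $F(M^*)$ is an elimination forest of $H$; 2. for every elimination forest $F$ of $H$ such that the chromatic number of $\mathsf{CG}(\mathbf t,F)$ is at most $q$, there is $M^*\in\mathbf{Tr}_q(M(H,\mathbf t))$ with $F(M^*)=F$. -/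

import Mathlib

universe u v

namespace TDToForest

/-! ## Hypergraphs, rooted forests, tree decompositions -/

/-- A finite hypergraph with non-empty edges and without isolated vertices. -/
structure FinHypergraph (α : Type u) extends Hypergraph α where
  finite_vertexSet : vertexSet.Finite
  edge_nonempty : ∀ e ∈ edgeSet, e.Nonempty
  no_isolated : ∀ w ∈ vertexSet, ∃ e ∈ edgeSet, w ∈ e

/-- A directed graph with an explicit set of vertices. -/
@[ext]
structure DirGraph (α : Type u) where
  verts : Set α
  arc : α → α → Prop

namespace DirGraph

variable {α : Type u} {β : Type v}

/-- The image of a directed graph under a map of the vertices. -/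
def image (D : DirGraph α) (f : α → β) : DirGraph β where
  verts := f '' D.verts
  arc x y := ∃ a b, D.arc a b ∧ f a = x ∧ f b = y

/-- `D` is a rooted forest, given by its arcs from parents to children: it is finite, every vertex
has at most one parent, and there is no directed cycle. -/
structure IsRootedForest (D : DirGraph α) : Prop where
  finite : D.verts.Finite
  arc_mem : ∀ x y, D.arc x y → x ∈ D.verts ∧ y ∈ D.verts
  parent_unique : ∀ x y z, D.arc x z → D.arc y z → x = y
  acyclic : ∀ x, ¬ Relation.TransGen D.arc x x

/-- `D.Ancestor x y`: `x` is an ancestor of `y`, equivalently `y` is a descendant of `x`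
(every vertex is an ancestor and a descendant of itself). -/
def Ancestor (D : DirGraph α) : α → α → Prop := Relation.ReflTransGen D.arc

/-- `x` is a root: a vertex without a parent. -/
def IsRoot (D : DirGraph α) (x : α) : Prop := x ∈ D.verts ∧ ∀ p, ¬ D.arc p x

/-- A rooted tree is a rooted forest with exactly one root. -/
def IsRootedTree (D : DirGraph α) : Prop := D.IsRootedForest ∧ ∃! r, D.IsRoot r

/-- The underlying undirected graph. -/
def graph (D : DirGraph α) : SimpleGraph α := SimpleGraph.fromRel D.arc

/-- The set of vertices on the path between `x` and `y` in the underlying undirected graph. -/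
def path (D : DirGraph α) (x y : α) : Set α :=
  {z | ∃ p : D.graph.Walk x y, p.IsPath ∧ z ∈ p.support}

/-- `F` is an elimination forest of the hypergraph `H`: a rooted forest on the vertices of `H` such
that any two vertices in a common edge are in the ancestor relation. -/
def IsEliminationForest (F : DirGraph α) (H : Hypergraph α) : Prop :=
  F.IsRootedForest ∧ F.verts = H.vertexSet ∧
    ∀ e ∈ H.edgeSet, ∀ x ∈ e, ∀ y ∈ e, F.Ancestor x y ∨ F.Ancestor y x

end DirGraph

/-- A (rooted) tree decomposition of `H` whose set of nodes is the type `N`. -/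
structure TreeDecomposition {α : Type u} (H : FinHypergraph α) (N : Type v) where
  tree : DirGraph N
  verts_eq : tree.verts = Set.univ
  isRootedTree : tree.IsRootedTree
  bag : N → Set α
  bag_subset : ∀ n, bag n ⊆ H.vertexSet
  edge_covered : ∀ e ∈ H.edgeSet, ∃ n, e ⊆ bag n
  bags_connected : ∀ w ∈ H.vertexSet, (tree.graph.induce {n | w ∈ bag n}).Connected

namespace TreeDecomposition

variable {α : Type u} {H : FinHypergraph α} {N : Type v}

/-- The adhesion of a node: the intersection of its bag with that of its parent
(empty for the root). -/
def adhesion (t : TreeDecomposition H N) (n : N) : Set α :=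
  {w | w ∈ t.bag n ∧ ∃ p, t.tree.arc p n ∧ w ∈ t.bag p}

/-- The margin of a node: its bag without its adhesion. -/
def margin (t : TreeDecomposition H N) (n : N) : Set α := t.bag n \ t.adhesion n

/-- Every vertex of `H` is in the margin of exactly one node. -/
theorem existsUnique_margin (t : TreeDecomposition H N) {w : α} (hw : w ∈ H.vertexSet) :
    ∃! n, w ∈ t.margin n := by
  have hf := t.isRootedTree.1
  have : Finite N := by
    have := hf.finite
    rw [t.verts_eq] at this
    exact Set.finite_univ_iff.mp this
  have hirr : Std.Irrefl (Relation.TransGen t.tree.arc) := ⟨hf.acyclic⟩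
  have hwf : WellFounded (Relation.TransGen t.tree.arc) :=
    Finite.wellFounded_of_trans_of_irrefl _
  obtain ⟨e, he, hwe⟩ := H.no_isolated w hw
  obtain ⟨n₀, hn₀⟩ := t.edge_covered e he
  obtain ⟨m, hm, hmin⟩ := hwf.has_min {n | w ∈ t.bag n} ⟨n₀, hn₀ hwe⟩
  have key : ∀ x y, w ∈ t.margin x → w ∈ t.bag y → Relation.ReflTransGen t.tree.arc x y := by
    intro x y hx hy
    have hr := (t.bags_connected w hw).preconnected ⟨x, hx.1⟩ ⟨y, hy⟩
    rw [SimpleGraph.reachable_iff_reflTransGen] at hr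
    suffices ∀ b : {n | w ∈ t.bag n},
        Relation.ReflTransGen (t.tree.graph.induce {n | w ∈ t.bag n}).Adj ⟨x, hx.1⟩ b →
        Relation.ReflTransGen t.tree.arc x b from this ⟨y, hy⟩ hr
    intro b hb
    induction hb with
    | refl => exact .refl
    | @tail b c _ hbc ih =>
      have hadj : t.tree.graph.Adj b c := hbc
      rw [DirGraph.graph, SimpleGraph.fromRel_adj] at hadj
      rcases hadj.2 with h | h
      · exact ih.tail h
      · rcases Relation.ReflTransGen.cases_tail ih with h0 | ⟨d, hxd, hdb⟩
        · exfalso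
          apply hx.2
          refine ⟨hx.1, c, ?_, c.2⟩
          rw [← h0]
          exact h
        · rw [hf.parent_unique _ _ _ h hdb]
          exact hxd
  refine ⟨m, ⟨hm, ?_⟩, ?_⟩
  · rintro ⟨-, p, hp, hwp⟩
    exact hmin p hwp (.single hp)
  · intro y hy
    rcases Relation.reflTransGen_iff_eq_or_transGen.mp (key y m hy hm) with h | h
    · exact h.symm
    · exact absurd h (hmin y hy.1)

/-- The margin node of a vertex `w`: the unique node with `w` in its margin. -/
noncomputable def marginNode (t : TreeDecomposition H N) (w : H.vertexSet) : N :=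
  (t.existsUnique_margin w.2).choose

/-- The stain of `w`: the margin node of `w`, together with the nodes on the paths between the
margin node of `w` and the margin nodes of the children of `w` in `F`. -/
def stain (t : TreeDecomposition H N) (F : DirGraph α) (w : H.vertexSet) : Set N :=
  {t.marginNode w} ∪
    {n | ∃ c : H.vertexSet, F.arc w c ∧ n ∈ t.tree.path (t.marginNode w) (t.marginNode c)}

/-- The conflict graph of `t` and `F`: distinct vertices of `H` are adjacent if and only if their
stains intersect. -/
def conflictGraph (t : TreeDecomposition H N) (F : DirGraph α) : SimpleGraph H.vertexSet where
  Adj x y := x ≠ y ∧ (t.stain F x ∩ t.stain F y).Nonempty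
  symm := ⟨fun _ _ h => ⟨h.1.symm, by rw [Set.inter_comm]; exact h.2⟩⟩
  loopless := ⟨fun _ h => h.1 rfl⟩

end TreeDecomposition

/-! ## Relational structures and monadic second-order logic -/

/-- A finite relational signature: `card` relation symbols with their arities. -/
structure Signature where
  card : ℕ
  arity : Fin card → ℕ

/-- The signature with one further symbol, of arity `a`, in front. -/
def Signature.extend (σ : Signature) (a : ℕ) : Signature := ⟨σ.card + 1, Fin.cons a σ.arity⟩

/-- A relational structure over `σ`, whose universe is a set of elements of `α`. -/
structure Struc (σ : Signature) (α : Type u) where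
  univ : Set α
  rel : (R : Fin σ.card) → (Fin (σ.arity R) → α) → Prop
  rel_mem : ∀ R x, rel R x → ∀ i, x i ∈ univ

/-- The structure with the given universe and with the restrictions of the given relations to it. -/
def Struc.ofRel {σ : Signature} {α : Type u} (U : Set α)
    (r : (R : Fin σ.card) → (Fin (σ.arity R) → α) → Prop) : Struc σ α where
  univ := U
  rel R x := (∀ i, x i ∈ U) ∧ r R x
  rel_mem _ _ h := h.1

/-- Adds to `M` an interpretation of the new symbol of `σ.extend a`: the restriction of `r` to the
universe. -/
def Struc.extend {σ : Signature} {α : Type u} (M : Struc σ α) (a : ℕ) (r : (Fin a → α) → Prop) :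
    Struc (σ.extend a) α where
  univ := M.univ
  rel := Fin.cons (α := fun R => (Fin ((σ.extend a).arity R) → α) → Prop)
    (fun x : Fin a → α => (∀ i, x i ∈ M.univ) ∧ r x) M.rel
  rel_mem := Fin.cases (fun _ h => h.1) M.rel_mem

/-- A unary relation as a relation on `1`-tuples. -/
def unary {α : Type u} (P : α → Prop) : (Fin 1 → α) → Prop := fun x => P (x 0)

/-- A binary relation as a relation on `2`-tuples. -/
def binary {α : Type u} (P : α → α → Prop) : (Fin 2 → α) → Prop := fun x => P (x 0) (x 1)

/-- MSO formulas over `σ` whose free variables are `n` element variables and `m` set variables.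
A quantifier binds variable `0` of its body; the other variables are shifted by one. -/
inductive MSO (σ : Signature) : ℕ → ℕ → Type
  | falsum {n m : ℕ} : MSO σ n m
  | rel {n m : ℕ} (R : Fin σ.card) (x : Fin (σ.arity R) → Fin n) : MSO σ n m
  | eq {n m : ℕ} (x y : Fin n) : MSO σ n m
  | mem {n m : ℕ} (x : Fin n) (X : Fin m) : MSO σ n m
  | neg {n m : ℕ} (φ : MSO σ n m) : MSO σ n m
  | and {n m : ℕ} (φ ψ : MSO σ n m) : MSO σ n m
  | or {n m : ℕ} (φ ψ : MSO σ n m) : MSO σ n m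
  | imp {n m : ℕ} (φ ψ : MSO σ n m) : MSO σ n m
  | ex {n m : ℕ} (φ : MSO σ (n + 1) m) : MSO σ n m
  | all {n m : ℕ} (φ : MSO σ (n + 1) m) : MSO σ n m
  | exSet {n m : ℕ} (φ : MSO σ n (m + 1)) : MSO σ n m
  | allSet {n m : ℕ} (φ : MSO σ n (m + 1)) : MSO σ n m

namespace MSO

variable {σ : Signature}

/-- Satisfaction in `M`, for the assignment `s` of elements and the assignment `S` of sets. -/
def Holds {α : Type u} (M : Struc σ α) :
    {n m : ℕ} → MSO σ n m → (Fin n → α) → (Fin m → Set α) → Prop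
  | _, _, falsum, _, _ => False
  | _, _, rel R x, s, _ => M.rel R (fun i => s (x i))
  | _, _, eq x y, s, _ => s x = s y
  | _, _, mem x X, s, S => s x ∈ S X
  | _, _, neg φ, s, S => ¬ Holds M φ s S
  | _, _, and φ ψ, s, S => Holds M φ s S ∧ Holds M ψ s S
  | _, _, or φ ψ, s, S => Holds M φ s S ∨ Holds M ψ s S
  | _, _, imp φ ψ, s, S => Holds M φ s S → Holds M ψ s S
  | _, _, ex φ, s, S => ∃ a ∈ M.univ, Holds M φ (Fin.cons a s) S
  | _, _, all φ, s, S => ∀ a ∈ M.univ, Holds M φ (Fin.cons a s) S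
  | _, _, exSet φ, s, S => ∃ A ⊆ M.univ, Holds M φ s (Fin.cons A S)
  | _, _, allSet φ, s, S => ∀ A ⊆ M.univ, Holds M φ s (Fin.cons A S)

/-- The number of symbols of a formula: relation symbols, occurrences of variables, equality and
membership signs, connectives and quantifiers. -/
def size : {n m : ℕ} → MSO σ n m → ℕ
  | _, _, falsum => 1
  | _, _, rel R _ => 1 + σ.arity R
  | _, _, eq _ _ => 3
  | _, _, mem _ _ => 3
  | _, _, neg φ => 1 + size φ
  | _, _, and φ ψ => 1 + size φ + size ψ
  | _, _, or φ ψ => 1 + size φ + size ψ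
  | _, _, imp φ ψ => 1 + size φ + size ψ
  | _, _, ex φ => 2 + size φ
  | _, _, all φ => 2 + size φ
  | _, _, exSet φ => 2 + size φ
  | _, _, allSet φ => 2 + size φ

/-- The formula in prefix notation, as a word of natural numbers. -/
def code : {n m : ℕ} → MSO σ n m → List ℕ
  | _, _, falsum => [0]
  | _, _, rel R x => 1 :: R.val :: List.ofFn (fun i => (x i).val)
  | _, _, eq x y => [2, x.val, y.val]
  | _, _, mem x X => [3, x.val, X.val]
  | _, _, neg φ => 4 :: code φ
  | _, _, and φ ψ => 5 :: (code φ ++ code ψ)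
  | _, _, or φ ψ => 6 :: (code φ ++ code ψ)
  | _, _, imp φ ψ => 7 :: (code φ ++ code ψ)
  | _, _, ex φ => 8 :: code φ
  | _, _, all φ => 9 :: code φ
  | _, _, exSet φ => 10 :: code φ
  | _, _, allSet φ => 11 :: code φ

end MSO

/-! ## MSO transductions -/

/-- Elements of the structures that arise from structures with universe in `A`: an element of `A`
with the list of the numbers of the copies that it went through (the last copy first). -/
abbrev Elt (A : Type u) : Type u := A × List ℕ

/-- An element of `A` before any copying. -/
def base {A : Type u} (a : A) : Elt A := (a, [])

/-- The `i`-th copy of an element. -/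
def copyOf {A : Type u} (i : ℕ) (x : Elt A) : Elt A := (x.1, i :: x.2)

/-- `k` further unary symbols. -/
def Signature.addUnary (σ : Signature) : ℕ → Signature
  | 0 => σ
  | k + 1 => (σ.addUnary k).extend 1

/-- The output signature of `k`-copying: a binary symbol that relates the copies of the same
element, and `k` unary symbols for the layers. -/
def Signature.copy (σ : Signature) (k : ℕ) : Signature := (σ.extend 2).addUnary k

namespace Struc

variable {σ : Signature} {A : Type u}

/-- `k` disjoint copies of the universe; a tuple is in a relation if and only if the tuple of its
original elements is. -/
def replicate (M : Struc σ (Elt A)) (k : ℕ) : Struc σ (Elt A) where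
  univ := {x | ∃ i < k, ∃ a ∈ M.univ, x = copyOf i a}
  rel R x := ∃ y, M.rel R y ∧ ∀ j, ∃ i < k, x j = copyOf i (y j)
  rel_mem := by
    rintro R x ⟨y, hy, h⟩ j
    obtain ⟨i, hi, hx⟩ := h j
    exact ⟨i, hi, y j, M.rel_mem R y hy j, hx⟩

/-- The unary predicates of the layers `0, …, k - 1`. -/
def addLayers (M : Struc σ (Elt A)) : (k : ℕ) → Struc (σ.addUnary k) (Elt A)
  | 0 => M
  | k + 1 => (M.addLayers k).extend 1 (unary fun x => ∃ a, x = copyOf k a)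

/-- The output of `k`-copying. -/
def copy (M : Struc σ (Elt A)) (k : ℕ) : Struc (σ.copy k) (Elt A) :=
  ((M.replicate k).extend 2
    (binary fun x y => ∃ a i j, x = copyOf i a ∧ y = copyOf j a)).addLayers k

/-- The restriction of a structure to a part of its universe. -/
def restrict (M : Struc σ (Elt A)) (P : Elt A → Prop) : Struc σ (Elt A) :=
  ofRel {x | x ∈ M.univ ∧ P x} M.rel

end Struc

/-- Elementary MSO transductions with given input and output signatures. -/
inductive Elementary : Signature → Signature → Type
  | colouring {σ : Signature} : Elementary σ (σ.extend 1)
  | copying {σ : Signature} (k : ℕ) (hk : 1 ≤ k) : Elementary σ (σ.copy k)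
  | interpretation {σ τ : Signature} (φ : (R : Fin τ.card) → MSO σ (τ.arity R) 0) : Elementary σ τ
  | filtering {σ : Signature} (φ : MSO σ 0 0) : Elementary σ σ
  | restriction {σ : Signature} (φ : MSO σ 1 0) : Elementary σ σ

namespace Elementary

/-- The set of outputs on a given input structure. -/
def apply {A : Type u} : {σ τ : Signature} → Elementary σ τ → Struc σ (Elt A) →
    Set (Struc τ (Elt A))
  | _, _, colouring, M => {M' | ∃ X ⊆ M.univ, M' = M.extend 1 (unary fun x => x ∈ X)}
  | _, _, copying k _, M => {M.copy k}
  | _, _, interpretation φ, M =>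
      {Struc.ofRel M.univ fun R x => (φ R).Holds M x Fin.elim0}
  | _, _, filtering φ, M => {M' | M' = M ∧ φ.Holds M Fin.elim0 Fin.elim0}
  | _, _, restriction φ, M => {M.restrict fun x => φ.Holds M (fun _ => x) Fin.elim0}

/-- The size of an elementary transduction. -/
def size : {σ τ : Signature} → Elementary σ τ → ℕ
  | _, _, colouring => 1
  | _, _, copying k _ => k
  | _, _, interpretation φ => ∑ R, (φ R).size
  | _, _, filtering φ => φ.size
  | _, _, restriction φ => φ.size

/-- An elementary transduction as a word of natural numbers. -/
def code : {σ τ : Signature} → Elementary σ τ → List ℕ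
  | _, _, colouring => [0]
  | _, _, copying k _ => [1, k]
  | _, _, interpretation (τ := τ) φ =>
      2 :: τ.card :: (List.ofFn τ.arity ++ (List.ofFn fun R => (φ R).code).flatten)
  | _, _, filtering φ => 3 :: φ.code
  | _, _, restriction φ => 4 :: φ.code

end Elementary

/-- MSO transductions: non-empty sequences of elementary transductions, the output signature of each
being the input signature of the next. -/
inductive Transduction : Signature → Signature → Type
  | single {σ τ : Signature} (g : Elementary σ τ) : Transduction σ τ
  | cons {σ ρ τ : Signature} (g : Elementary σ ρ) (T : Transduction ρ τ) : Transduction σ τ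

namespace Transduction

/-- The set of outputs of a transduction on a given input structure. -/
def apply {A : Type u} : {σ τ : Signature} → Transduction σ τ → Struc σ (Elt A) →
    Set (Struc τ (Elt A))
  | _, _, single g, M => g.apply M
  | _, _, cons g T, M => ⋃ M' ∈ g.apply M, T.apply M'

/-- The size of a transduction: the sum of the sizes of its elementary transductions. -/
def size : {σ τ : Signature} → Transduction σ τ → ℕ
  | _, _, single g => g.size
  | _, _, cons g T => g.size + T.size

/-- A transduction as a word of natural numbers; this is what an algorithm outputs. -/
def code : {σ τ : Signature} → Transduction σ τ → List ℕ
  | _, _, single g => 0 :: g.code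
  | _, _, cons g T => 1 :: (g.code ++ T.code)

end Transduction

/-! The words above determine the formulas and the transductions. -/

theorem ofFn_append_inj {n : ℕ} (f g : Fin n → ℕ) (l l' : List ℕ)
    (h : List.ofFn f ++ l = List.ofFn g ++ l') : f = g ∧ l = l' := by
  obtain ⟨h1, h2⟩ := List.append_inj h (by simp)
  exact ⟨List.ofFn_injective h1, h2⟩

theorem MSO.code_append_inj {σ : Signature} {n m : ℕ} (φ ψ : MSO σ n m) (l l' : List ℕ)
    (h : φ.code ++ l = ψ.code ++ l') : φ = ψ ∧ l = l' := by
  induction φ generalizing l l' with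
  | rel R x =>
    cases ψ <;> simp [MSO.code] at h
    rename_i R' x'
    obtain ⟨h1, h2⟩ := h
    obtain rfl := Fin.ext h1
    obtain ⟨h3, h4⟩ := ofFn_append_inj _ _ _ _ h2
    refine ⟨?_, h4⟩
    congr 1
    funext i
    exact Fin.ext (congrFun h3 i)
  | and a b iha ihb | or a b iha ihb | imp a b iha ihb =>
    cases ψ <;> simp [MSO.code] at h
    obtain ⟨rfl, h1⟩ := iha _ _ _ h
    obtain ⟨rfl, h2⟩ := ihb _ _ _ h1
    exact ⟨rfl, h2⟩
  | neg a iha | ex a iha | all a iha | exSet a iha | allSet a iha =>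
    cases ψ <;> simp [MSO.code] at h
    obtain ⟨rfl, h1⟩ := iha _ _ _ h
    exact ⟨rfl, h1⟩
  | _ =>
    cases ψ <;> simp [MSO.code] at h
    all_goals grind

theorem code_flatten_inj {σ : Signature} : ∀ {k : ℕ} (ar : Fin k → ℕ)
    (φ ψ : (R : Fin k) → MSO σ (ar R) 0) (l l' : List ℕ)
    (_ : (List.ofFn fun R => (φ R).code).flatten ++ l =
      (List.ofFn fun R => (ψ R).code).flatten ++ l'), φ = ψ ∧ l = l' := by
  intro k
  induction k with
  | zero => intro ar φ ψ l l' h; exact ⟨funext fun i => i.elim0, by simpa using h⟩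
  | succ k ih =>
    intro ar φ ψ l l' h
    simp only [List.ofFn_succ, List.flatten_cons, List.append_assoc] at h
    obtain ⟨h0, h1⟩ := MSO.code_append_inj _ _ _ _ h
    obtain ⟨h2, h3⟩ := ih (fun i => ar i.succ) (fun i => φ i.succ) (fun i => ψ i.succ) _ _ h1
    exact ⟨funext (Fin.cases h0 (congrFun h2)), h3⟩

theorem Elementary.code_append_inj {σ τ τ' : Signature} (g : Elementary σ τ) (g' : Elementary σ τ') (l l' : List ℕ)
    (h : g.code ++ l = g'.code ++ l') : τ = τ' ∧ HEq g g' ∧ l = l' := by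
  cases g <;> cases g' <;> simp [Elementary.code] at h
  · exact ⟨rfl, HEq.rfl, h⟩
  · obtain ⟨rfl, h⟩ := h
    exact ⟨rfl, HEq.rfl, h⟩
  · rename_i φ ψ
    obtain ⟨h0, h⟩ := h
    cases τ
    cases τ'
    simp at h0
    subst h0
    obtain ⟨h1, h⟩ := ofFn_append_inj _ _ _ _ h
    simp at h1
    subst h1
    obtain ⟨rfl, h2⟩ := code_flatten_inj _ _ _ _ _ h
    exact ⟨rfl, HEq.rfl, h2⟩
  · obtain ⟨rfl, h1⟩ := MSO.code_append_inj _ _ _ _ h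
    exact ⟨rfl, HEq.rfl, h1⟩
  · obtain ⟨rfl, h1⟩ := MSO.code_append_inj _ _ _ _ h
    exact ⟨rfl, HEq.rfl, h1⟩

/-- The word of a transduction determines the transduction. -/
theorem Transduction.code_injective {σ τ : Signature} (T T' : Transduction σ τ)
    (h : T.code = T'.code) : T = T' := by
  induction T with
  | single g =>
    cases T' <;> simp [Transduction.code] at h
    obtain ⟨-, h, -⟩ := Elementary.code_append_inj g _ [] [] (by simpa using h)
    rw [eq_of_heq h]
  | cons g T ih =>
    cases T' <;> simp [Transduction.code] at h
    obtain ⟨rfl, h1, h2⟩ := Elementary.code_append_inj _ _ _ _ h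
    rw [eq_of_heq h1, ih _ h2]

/-! ## The structures of tree decompositions and elimination forests -/

/-- The signature of tree decompositions, with symbols (in this order) `Vertex`, `Edge`, `Node`,
`Bag`, `Adjacent`, `Descendant`. -/
abbrev sigTD : Signature := ⟨6, ![1, 1, 1, 2, 2, 2]⟩

/-- The signature of elimination forests, with symbols (in this order) `Vertex`, `Edge`, `Child`,
`Adjacent`. -/
abbrev sigEF : Signature := ⟨4, ![1, 1, 2, 2]⟩

/-- The elements of the structure of a tree decomposition: vertices and edges of the hypergraph, and
nodes of the tree. -/
inductive Obj (α : Type u) (N : Type v) : Type (max u v)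
  | vertex (w : α)
  | edge (e : Set α)
  | node (n : N)

/-- A vertex of the hypergraph as an element of the structure. -/
def vtx {α : Type u} (N : Type v) (w : α) : Elt (Obj α N) := base (Obj.vertex w)

/-- The structure `M(H, t)` over `sigTD` induced by `H` and `t`. `Bag x y` says that the vertex `x`
is in the bag of the node `y`, `Adjacent x y` that the vertex `x` is in the edge `y`, and
`Descendant x y` that the node `y` is a descendant of the node `x`. -/
def TreeDecomposition.struc {α : Type u} {H : FinHypergraph α} {N : Type v}
    (t : TreeDecomposition H N) : Struc sigTD (Elt (Obj α N)) :=
  Struc.ofRel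
    {x | (∃ w ∈ H.vertexSet, x = base (.vertex w)) ∨ (∃ e ∈ H.edgeSet, x = base (.edge e)) ∨
      ∃ n, x = base (.node n)}
    fun
    | 0 => unary fun x => ∃ w, x = base (.vertex w)
    | 1 => unary fun x => ∃ e, x = base (.edge e)
    | 2 => unary fun x => ∃ n, x = base (.node n)
    | 3 => binary fun x y => ∃ w n, x = base (.vertex w) ∧ y = base (.node n) ∧ w ∈ t.bag n
    | 4 => binary fun x y => ∃ w e, x = base (.vertex w) ∧ y = base (.edge e) ∧ w ∈ e
    | 5 => binary fun x y => ∃ m n, x = base (.node m) ∧ y = base (.node n) ∧ t.tree.Ancestor m n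

namespace Struc

variable {α : Type u}

/-- `Vertex` in a structure over `sigEF`. -/
def Vertex (M : Struc sigEF α) (x : α) : Prop := M.rel (0 : Fin 4) (![x] : Fin 1 → α)

/-- `Edge` in a structure over `sigEF`. -/
def Edge (M : Struc sigEF α) (x : α) : Prop := M.rel (1 : Fin 4) (![x] : Fin 1 → α)

/-- `Child x y` in a structure over `sigEF`: `y` is a child of `x`. -/
def Child (M : Struc sigEF α) (x y : α) : Prop := M.rel (2 : Fin 4) (![x, y] : Fin 2 → α)

/-- `Adjacent x y` in a structure over `sigEF`: the vertex `x` is in the edge `y`. -/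
def Adjacent (M : Struc sigEF α) (x y : α) : Prop := M.rel (3 : Fin 4) (![x, y] : Fin 2 → α)

/-- `Vertex`, `Edge` and `Adjacent` form the incidence graph of a hypergraph. -/
structure IsIncidence (M : Struc sigEF α) : Prop where
  disjoint : ∀ x, M.Vertex x → ¬ M.Edge x
  adjacent_mem : ∀ x y, M.Adjacent x y → M.Vertex x ∧ M.Edge y
  edge_ext : ∀ y z, M.Edge y → M.Edge z → (∀ x, M.Adjacent x y ↔ M.Adjacent x z) → y = z

/-- The hypergraph `H(M)`. -/
def hypergraph (M : Struc sigEF α) : Hypergraph α where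
  vertexSet := {x | M.Vertex x}
  edgeSet := {e | ∃ y, M.Edge y ∧ e = {x | M.Vertex x ∧ M.Adjacent x y}}
  subset_vertexSet_of_mem_edgeSet' := by
    rintro e ⟨y, -, rfl⟩ x hx
    exact hx.1

/-- The directed graph `F(M)`. -/
def forest (M : Struc sigEF α) : DirGraph α where
  verts := {x | M.Vertex x}
  arc := M.Child

end Struc

end TDToForest

namespace TDToForest

open Relation

/-! Colour the conflict graph with `q` colours and let `K` be a colour class. The stains of the
vertices of `K` are pairwise disjoint, so one set of nodes encodes all of them at once: the set `Y`
of nodes that lie, together with their tree parent, in the stain of some vertex of `K`. Climbing in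
the tree along nodes of `Y` then never leaves a stain. With `V = K` and `P` the set of children of
vertices of `K`, the arcs of `F` that leave `K` are exactly the pairs `u ∈ V`, `v ∈ P` whose margin
nodes have a common ancestor `p` such that every node strictly below `p` on the way to either margin
node is in `Y` (`roundArc_of_arc`, `arc_of_roundArc`).

A round guesses `V`, `P`, `Y` by three colourings, adds the arcs so defined to a binary relation,
and forgets the three sets. The signature thus returns to `sigArcs`, the formulas do not depend on
`q`, and `q` rounds have size `O(q)`.

Guesses may be wrong, so a fixed sentence finally filters out every arc relation that is not an
elimination forest. This alone gives the first claim (`exists_of_mem_roundsTransduction`,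
`toEF_holds_forestSentence`), since the incidence relations are never changed. For the second claim
the guesses come from a proper colouring (`toEF_mem_forestTransduction`). -/

theorem Struc.ext_rel {σ : Signature} {α : Type u} {M M' : Struc σ α} (h : M.univ = M'.univ)
    (h' : ∀ R x, M.rel R x ↔ M'.rel R x) : M = M' := by
  obtain ⟨U, r, hr⟩ := M
  obtain ⟨U', r', hr'⟩ := M'
  obtain rfl : U = U' := h
  obtain rfl : r = r' := funext fun R => funext fun x => propext (h' R x)
  rfl

/-! ## Formulas -/

namespace MSO

variable {σ : Signature} {n m : ℕ}

/-- The atomic formula `R x` for a unary symbol `R`. -/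
def atom₁ (R : Fin σ.card) (x : Fin n) : MSO σ n m := rel R fun _ => x

/-- The atomic formula `R x y` for a binary symbol `R`. -/
def atom₂ (R : Fin σ.card) (x y : Fin n) : MSO σ n m := rel R fun i => if i.val = 0 then x else y

/-- `atom₂` makes sense for a symbol of any arity, hence its `if`; at arity 2 the tuple is the
literal `![_, _]` in which the relations are stated. -/
theorem comp_ite {α : Type u} (s : Fin n → α) (x y : Fin n) :
    (fun i : Fin 2 => s (if i.val = 0 then x else y)) = ![s x, s y] := by
  funext i
  fin_cases i <;> rfl

theorem comp_const {α : Type u} (a : α) : (fun _ : Fin 1 => a) = ![a] := by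
  funext i
  fin_cases i
  rfl

end MSO

/-! ## The guessing rounds -/

/-- The signature `sigTD` with a binary symbol in front, for the arcs found so far. -/
abbrev sigArcs : Signature := sigTD.extend 2

/-- The signature `sigArcs` with three unary symbols in front. -/
abbrev sigRound : Signature := ((sigArcs.extend 1).extend 1).extend 1

/-- The formula saying that node `a` is the margin node of vertex `u`. -/
def marginFormula {n : ℕ} (u a : Fin n) : MSO sigRound n 0 :=
  -- New symbols go in front: `0`, `1`, `2` are the sets `Y`, `P`, `V`, `3` is the arc relation, and
  -- `4` to `9` are the symbols of `sigTD`, so `7` is `Bag` and `9` is `Descendant`.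
  .and (.atom₂ (7 : Fin 10) u a)
    (.all (.imp (.atom₂ (7 : Fin 10) u.succ 0) (.atom₂ (9 : Fin 10) a.succ 0)))

/-- The formula defining the arcs found in a round; its free variables are the parent `0` and the
child `1`. -/
def arcFormula : MSO sigRound 2 0 :=
  .or (.atom₂ (3 : Fin 10) 0 1) <|
  .and (.atom₁ (2 : Fin 10) 0) <| .and (.atom₁ (1 : Fin 10) 1) <|
  .ex <| .ex <| .ex <|
  -- The variables `0, 1, 2, 3, 4` are now `p`, the margin nodes `b` and `a`, the parent and the
  -- child; the quantifier over `z` below shifts them by one. It is enough that `p` is some common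
  -- ancestor, not the lowest one.
  .and (marginFormula 3 2) <| .and (marginFormula 4 1) <|
  .and (.atom₂ (9 : Fin 10) 0 2) <| .and (.atom₂ (9 : Fin 10) 0 1) <|
  .all <| .imp (.and (.atom₂ (9 : Fin 10) 1 0)
      (.or (.atom₂ (9 : Fin 10) 0 3) (.atom₂ (9 : Fin 10) 0 2))) <|
    .or (.eq 0 1) (.atom₁ (0 : Fin 10) 0)

/-- `Bag` in a structure over `sigTD`. -/
def Struc.Bag {α : Type u} (M : Struc sigTD α) (x y : α) : Prop :=
  M.rel (3 : Fin 6) (![x, y] : Fin 2 → α)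

/-- `Descendant` in a structure over `sigTD`. -/
def Struc.Descendant {α : Type u} (M : Struc sigTD α) (x y : α) : Prop :=
  M.rel (5 : Fin 6) (![x, y] : Fin 2 → α)

/-- The meaning of `marginFormula`. -/
def Struc.IsMargin {α : Type u} (M : Struc sigTD α) (u a : α) : Prop :=
  M.Bag u a ∧ ∀ n ∈ M.univ, M.Bag u n → M.Descendant a n

/-- The arcs that a round adds, for parents in `V`, children in `P`, and the set `Y` of nodes that
are joined to their parents. -/
def Struc.RoundArc {α : Type u} (M : Struc sigTD α) (V P Y : Set α) (u v : α) : Prop :=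
  u ∈ V ∧ v ∈ P ∧ ∃ a ∈ M.univ, ∃ b ∈ M.univ, ∃ p ∈ M.univ, M.IsMargin u a ∧ M.IsMargin v b ∧
    M.Descendant p a ∧ M.Descendant p b ∧
    ∀ z ∈ M.univ, M.Descendant p z ∧ (M.Descendant z a ∨ M.Descendant z b) → z = p ∨ z ∈ Y

/-- The structure `M` with a relation of arcs. -/
def Struc.withArcs {α : Type u} (M : Struc sigTD α) (C : α → α → Prop) : Struc sigArcs α :=
  M.extend 2 (binary C)

/-- The structure `M` with a relation of arcs and three sets. -/
def Struc.withSets {α : Type u} (M : Struc sigTD α) (C : α → α → Prop) (V P Y : Set α) :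
    Struc sigRound α :=
  (((M.withArcs C).extend 1 (unary fun x => x ∈ V)).extend 1 (unary fun x => x ∈ P)).extend 1
    (unary fun x => x ∈ Y)

/-! ### Semantics of the round formulas -/

section holds

variable {α : Type u} (M : Struc sigTD α) (C : α → α → Prop) (V P Y : Set α) {n m : ℕ}
  (s : Fin n → α) (S : Fin m → Set α) (x y : Fin n)

theorem holds_bag : (MSO.atom₂ (σ := sigRound) (7 : Fin 10) x y).Holds (M.withSets C V P Y) s S ↔
    M.Bag (s x) (s y) := by
  rw [Struc.Bag, ← MSO.comp_ite]
  exact Iff.rfl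

theorem holds_descendant :
    (MSO.atom₂ (σ := sigRound) (9 : Fin 10) x y).Holds (M.withSets C V P Y) s S ↔
    M.Descendant (s x) (s y) := by
  rw [Struc.Descendant, ← MSO.comp_ite]
  exact Iff.rfl

/-- `Struc.extend` restricts an added relation to the universe, which is why membership is assumed
here and for the three sets, but not for the inherited symbols. -/
theorem holds_arc (hx : s x ∈ M.univ) (hy : s y ∈ M.univ) :
    (MSO.atom₂ (σ := sigRound) (3 : Fin 10) x y).Holds (M.withSets C V P Y) s S ↔
    C (s x) (s y) := by
  refine Iff.trans (b := (∀ i : Fin 2, s (if i.val = 0 then x else y) ∈ M.univ) ∧ C (s x) (s y))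
    Iff.rfl ⟨fun h => h.2, fun h => ⟨fun i => ?_, h⟩⟩
  split <;> assumption

theorem holds_set₂ (hx : s x ∈ M.univ) :
    (MSO.atom₁ (σ := sigRound) (2 : Fin 10) x).Holds (M.withSets C V P Y) s S ↔ s x ∈ V :=
  Iff.trans (b := (∀ _ : Fin 1, s x ∈ M.univ) ∧ s x ∈ V) Iff.rfl (by simp [hx])

theorem holds_set₁ (hx : s x ∈ M.univ) :
    (MSO.atom₁ (σ := sigRound) (1 : Fin 10) x).Holds (M.withSets C V P Y) s S ↔ s x ∈ P :=
  Iff.trans (b := (∀ _ : Fin 1, s x ∈ M.univ) ∧ s x ∈ P) Iff.rfl (by simp [hx])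

theorem holds_set₀ (hx : s x ∈ M.univ) :
    (MSO.atom₁ (σ := sigRound) (0 : Fin 10) x).Holds (M.withSets C V P Y) s S ↔ s x ∈ Y :=
  Iff.trans (b := (∀ _ : Fin 1, s x ∈ M.univ) ∧ s x ∈ Y) Iff.rfl (by simp [hx])

theorem holds_marginFormula (S : Fin 0 → Set α) :
    (marginFormula x y).Holds (M.withSets C V P Y) s S ↔ M.IsMargin (s x) (s y) := by
  simp only [marginFormula, MSO.Holds, holds_bag, holds_descendant, Fin.cons_succ, Fin.cons_zero]
  exact Iff.rfl

theorem holds_arcFormula (s : Fin 2 → α) (hs : ∀ i, s i ∈ M.univ) (S : Fin 0 → Set α) :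
    arcFormula.Holds (M.withSets C V P Y) s S ↔
      C (s 0) (s 1) ∨ M.RoundArc V P Y (s 0) (s 1) := by
  simp only [arcFormula, MSO.Holds, holds_descendant, holds_marginFormula,
    holds_arc _ _ _ _ _ s _ _ _ (hs 0) (hs 1), holds_set₂ _ _ _ _ _ s _ _ (hs 0),
    holds_set₁ _ _ _ _ _ s _ _ (hs 1)]
  refine or_congr Iff.rfl (and_congr Iff.rfl (and_congr Iff.rfl ?_))
  refine exists_congr fun a => and_congr Iff.rfl (exists_congr fun b => and_congr Iff.rfl
    (exists_congr fun p => and_congr Iff.rfl ?_))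
  refine and_congr Iff.rfl (and_congr Iff.rfl (and_congr Iff.rfl (and_congr Iff.rfl ?_)))
  refine forall_congr' fun z => forall_congr' fun hz => ?_
  rw [holds_set₀ _ _ _ _ _ _ _ _ (by exact hz)]
  exact Iff.rfl

end holds

/-- The formulas of `roundInterpretation`. -/
def roundFormulas : (R : Fin sigArcs.card) → MSO sigRound (sigArcs.arity R) 0 :=
  -- The symbol `R` of `sigTD` sits behind the arcs and the three sets.
  Fin.cases arcFormula fun R => .rel R.succ.succ.succ.succ fun i => i

/-- The interpretation that ends a round: it adds the new arcs and forgets the three sets. -/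
def roundInterpretation : Elementary sigRound sigArcs := .interpretation roundFormulas

theorem roundInterpretation_apply {A : Type u} (M : Struc sigTD (Elt A)) (C : Elt A → Elt A → Prop)
    (V P Y : Set (Elt A)) :
    roundInterpretation.apply (M.withSets C V P Y) =
      {M.withArcs fun x y => C x y ∨ M.RoundArc V P Y x y} := by
  have : Struc.ofRel M.univ (fun R x => (roundFormulas R).Holds (M.withSets C V P Y) x Fin.elim0) =
      M.withArcs fun x y => C x y ∨ M.RoundArc V P Y x y := by
    refine Struc.ext_rel rfl (Fin.cases (fun s => ?_) (fun R s => ?_))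
    · exact and_congr_right fun hs => holds_arcFormula M C V P Y s hs _
    · exact ⟨fun h => h.2, fun h => ⟨M.rel_mem R _ h, h⟩⟩
  exact congrArg singleton this

/-- The formula over `sigEF` saying that the set `X` contains every child of each of its elements. -/
def closedFormula {n m : ℕ} (X : Fin m) : MSO sigEF n m :=
  .all <| .all <| .imp (.and (.mem 1 X) (.atom₂ (2 : Fin 4) 1 0)) (.mem 0 X)

/-- The formula over `sigEF` saying that `x` is an ancestor of `y`. -/
def ancestorFormula {n m : ℕ} (x y : Fin n) : MSO sigEF n m :=
  .allSet <| .imp (.mem x 0) <| .imp (closedFormula 0) (.mem y 0)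

/-- The sentence over `sigEF` saying that the arcs form an elimination forest. -/
def forestSentence : MSO sigEF 0 0 :=
  .and (.all <| .all <| .imp (.atom₂ (2 : Fin 4) 1 0)
    (.and (.atom₁ (0 : Fin 4) 1) (.atom₁ (0 : Fin 4) 0))) <|
  .and (.all <| .all <| .all <| .imp (.and (.atom₂ (2 : Fin 4) 2 0) (.atom₂ (2 : Fin 4) 1 0))
    (.eq 2 1)) <|
  -- Acyclicity: every non-empty set has an element without a parent in the set. For finitely many
  -- vertices this is equivalent to the absence of directed cycles.
  .and (.allSet <| .imp (.ex <| .mem 0 0) <| .ex <| .and (.mem 0 0) <| .all <|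
    .imp (.mem 0 0) (.neg (.atom₂ (2 : Fin 4) 0 1))) <|
  .all <| .all <| .all <| .imp (.and (.atom₂ (3 : Fin 4) 1 2) (.atom₂ (3 : Fin 4) 0 2))
    (.or (ancestorFormula 1 0) (ancestorFormula 0 1))

/-! ### Semantics of the final sentence -/

section holdsEF

variable {α : Type u} (M : Struc sigEF α) {n m : ℕ} (s : Fin n → α) (S : Fin m → Set α)
  (x y : Fin n)

theorem holds_vertex :
    (MSO.atom₁ (σ := sigEF) (0 : Fin 4) x).Holds M s S ↔ M.Vertex (s x) := by
  rw [Struc.Vertex, ← MSO.comp_const]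
  exact Iff.rfl

theorem holds_child :
    (MSO.atom₂ (σ := sigEF) (2 : Fin 4) x y).Holds M s S ↔ M.Child (s x) (s y) := by
  rw [Struc.Child, ← MSO.comp_ite]
  exact Iff.rfl

theorem holds_adjacent :
    (MSO.atom₂ (σ := sigEF) (3 : Fin 4) x y).Holds M s S ↔ M.Adjacent (s x) (s y) := by
  rw [Struc.Adjacent, ← MSO.comp_ite]
  exact Iff.rfl

theorem Struc.child_mem {M : Struc sigEF α} {a b : α} (h : M.Child a b) :
    a ∈ M.univ ∧ b ∈ M.univ :=
  ⟨M.rel_mem _ _ h (0 : Fin 2), M.rel_mem _ _ h (1 : Fin 2)⟩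

theorem Struc.adjacent_mem {M : Struc sigEF α} {a b : α} (h : M.Adjacent a b) :
    a ∈ M.univ ∧ b ∈ M.univ :=
  ⟨M.rel_mem _ _ h (0 : Fin 2), M.rel_mem _ _ h (1 : Fin 2)⟩

/-- The descendants of `s x` form the least child-closed set containing it: instantiating the set
quantifier with them gives one direction, induction along a directed path the other. -/
theorem holds_ancestorFormula (hx : s x ∈ M.univ) :
    (ancestorFormula x y).Holds M s S ↔ M.forest.Ancestor (s x) (s y) := by
  simp only [ancestorFormula, closedFormula, MSO.Holds, holds_child]
  constructor
  · intro h
    exact (h {b | b ∈ M.univ ∧ M.forest.Ancestor (s x) b} (fun _ hb => hb.1) ⟨hx, .refl⟩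
      fun a _ b hb hab => ⟨hb, hab.1.2.tail hab.2⟩).2
  · intro h X _ hxX hX
    refine ReflTransGen.head_induction_on (motive := fun a _ => a ∈ X → s y ∈ X) h id ?_ hxX
    exact fun hab _ ih ha => ih (hX _ (Struc.child_mem hab).1 _ (Struc.child_mem hab).2 ⟨ha, hab⟩)

theorem holds_forestSentence (s : Fin 0 → α) (S : Fin 0 → Set α) :
    forestSentence.Holds M s S ↔
      (∀ x ∈ M.univ, ∀ y ∈ M.univ, M.Child x y → M.Vertex x ∧ M.Vertex y) ∧
      (∀ x ∈ M.univ, ∀ y ∈ M.univ, ∀ z ∈ M.univ, M.Child x z ∧ M.Child y z → x = y) ∧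
      (∀ X ⊆ M.univ, (∃ x ∈ M.univ, x ∈ X) →
        ∃ x ∈ M.univ, x ∈ X ∧ ∀ y ∈ M.univ, y ∈ X → ¬ M.Child y x) ∧
      ∀ e ∈ M.univ, ∀ x ∈ M.univ, ∀ y ∈ M.univ, M.Adjacent x e ∧ M.Adjacent y e →
        M.forest.Ancestor x y ∨ M.forest.Ancestor y x := by
  simp only [forestSentence, MSO.Holds, holds_child, holds_vertex, holds_adjacent]
  refine and_congr Iff.rfl (and_congr Iff.rfl (and_congr Iff.rfl ?_))
  refine forall₂_congr fun e _ => forall₂_congr fun x hx => forall₂_congr fun y hy => ?_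
  rw [holds_ancestorFormula _ _ _ _ _ (by exact hx), holds_ancestorFormula _ _ _ _ _ (by exact hy)]
  exact Iff.rfl

end holdsEF

/-- The formulas of `finalInterpretation`. -/
def finalFormulas : (R : Fin sigEF.card) → MSO sigArcs (sigEF.arity R) 0
  | 0 => .rel (1 : Fin 7) fun i => i
  | 1 => .rel (2 : Fin 7) fun i => i
  | 2 => .rel (0 : Fin 7) fun i => i
  | 3 => .rel (5 : Fin 7) fun i => i

/-- The interpretation that forgets the tree decomposition. -/
def finalInterpretation : Elementary sigArcs sigEF := .interpretation finalFormulas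

/-- The structure over `sigEF` that results from `M` and a relation of arcs. -/
def Struc.toEF {α : Type u} (M : Struc sigTD α) (C : α → α → Prop) : Struc sigEF α :=
  -- The nodes stay in the universe; this is harmless, as `hypergraph` and `forest` read only the
  -- relations.
  Struc.ofRel M.univ fun
    | 0 => M.rel (0 : Fin 6)
    | 1 => M.rel (1 : Fin 6)
    | 2 => binary C
    | 3 => M.rel (4 : Fin 6)

theorem finalInterpretation_apply {A : Type u} (M : Struc sigTD (Elt A))
    (C : Elt A → Elt A → Prop) : finalInterpretation.apply (M.withArcs C) = {M.toEF C} := by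
  have : Struc.ofRel M.univ (fun R x => (finalFormulas R).Holds (M.withArcs C) x Fin.elim0) =
      M.toEF C := by
    refine Struc.ext_rel rfl fun R s => ?_
    fin_cases R
    · exact Iff.rfl
    · exact Iff.rfl
    · exact and_congr_right fun hs => ⟨fun h => h.2, fun h => ⟨hs, h⟩⟩
    · exact Iff.rfl
  exact congrArg singleton this

/-- The guessing rounds, followed by the final check. -/
def roundsTransduction : ℕ → Transduction sigArcs sigEF
  | 0 => .cons finalInterpretation (.single (.filtering forestSentence))
  | q + 1 => .cons .colouring <| .cons .colouring <| .cons .colouring <|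
      .cons roundInterpretation (roundsTransduction q)

/-- The formulas of the interpretation that adds an empty relation of arcs. -/
def initialFormulas : (R : Fin sigArcs.card) → MSO sigTD (sigArcs.arity R) 0 :=
  Fin.cases .falsum fun R => .rel R fun i => i

/-- The transduction from tree decompositions to elimination forests. -/
def forestTransduction (q : ℕ) : Transduction sigTD sigEF :=
  .cons (.interpretation initialFormulas) (roundsTransduction q)

/-! ### Outputs of the transduction -/

section apply

variable {A : Type u} (M : Struc sigTD (Elt A))

theorem mem_roundsTransduction_zero (C : Elt A → Elt A → Prop) (M' : Struc sigEF (Elt A)) :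
    M' ∈ (roundsTransduction 0).apply (M.withArcs C) ↔
      M' = M.toEF C ∧ forestSentence.Holds (M.toEF C) Fin.elim0 Fin.elim0 := by
  rw [roundsTransduction, Transduction.apply, finalInterpretation_apply, Set.mem_iUnion]
  simp only [Set.mem_iUnion, Set.mem_singleton_iff, exists_prop, exists_eq_left]
  exact ⟨fun h => ⟨h.1, h.1 ▸ h.2⟩, fun h => ⟨h.1, h.1 ▸ h.2⟩⟩

theorem mem_roundsTransduction_succ (q : ℕ) (C : Elt A → Elt A → Prop)
    (M' : Struc sigEF (Elt A)) :
    M' ∈ (roundsTransduction (q + 1)).apply (M.withArcs C) ↔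
      ∃ V ⊆ M.univ, ∃ P ⊆ M.univ, ∃ Y ⊆ M.univ, M' ∈ (roundsTransduction q).apply
        (M.withArcs fun x y => C x y ∨ M.RoundArc V P Y x y) := by
  rw [roundsTransduction]
  simp only [Transduction.apply, Set.mem_iUnion, exists_prop]
  constructor
  · rintro ⟨_, ⟨V, hV, rfl⟩, _, ⟨P, hP, rfl⟩, _, ⟨Y, hY, rfl⟩, M₁, h₁, h⟩
    refine ⟨V, hV, P, hP, Y, hY, ?_⟩
    rw [show M₁ = _ from (roundInterpretation_apply M C V P Y).subset h₁] at h
    exact h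
  · rintro ⟨V, hV, P, hP, Y, hY, h⟩
    exact ⟨_, ⟨V, hV, rfl⟩, _, ⟨P, hP, rfl⟩, _, ⟨Y, hY, rfl⟩, _,
      (roundInterpretation_apply M C V P Y).symm.subset rfl, h⟩

/-- Soundness ignores what was guessed: a round changes nothing but the arcs. -/
theorem exists_of_mem_roundsTransduction (q : ℕ) (C : Elt A → Elt A → Prop)
    (M' : Struc sigEF (Elt A)) (h : M' ∈ (roundsTransduction q).apply (M.withArcs C)) :
    ∃ C', M' = M.toEF C' ∧ forestSentence.Holds (M.toEF C') Fin.elim0 Fin.elim0 := by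
  induction q generalizing C with
  | zero => exact ⟨C, (mem_roundsTransduction_zero M C M').mp h⟩
  | succ q ih =>
    obtain ⟨V, -, P, -, Y, -, h⟩ := (mem_roundsTransduction_succ M q C M').mp h
    exact ih _ h

/-- Here `C` collects the arcs of the rounds already played. Indices count down, so the round played
first uses the sets of largest index. -/
theorem mem_roundsTransduction (q : ℕ) (C : Elt A → Elt A → Prop) (V P Y : ℕ → Set (Elt A))
    (hV : ∀ i, V i ⊆ M.univ) (hP : ∀ i, P i ⊆ M.univ) (hY : ∀ i, Y i ⊆ M.univ)
    (D : Elt A → Elt A → Prop)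
    (hD : ∀ x y, D x y ↔ C x y ∨ ∃ i < q, M.RoundArc (V i) (P i) (Y i) x y)
    (h : forestSentence.Holds (M.toEF D) Fin.elim0 Fin.elim0) :
    M.toEF D ∈ (roundsTransduction q).apply (M.withArcs C) := by
  induction q generalizing C with
  | zero =>
    obtain rfl : D = C := by
      funext x y
      simpa using hD x y
    exact (mem_roundsTransduction_zero M D _).mpr ⟨rfl, h⟩
  | succ q ih =>
    refine (mem_roundsTransduction_succ M q C _).mpr
      ⟨V q, hV q, P q, hP q, Y q, hY q, ih _ fun x y => ?_⟩
    rw [hD, or_assoc]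
    refine or_congr_right ⟨?_, ?_⟩
    · rintro ⟨i, hi, h⟩
      rcases Nat.lt_succ_iff_lt_or_eq.mp hi with hi | rfl
      · exact .inr ⟨i, hi, h⟩
      · exact .inl h
    · rintro (h | ⟨i, hi, h⟩)
      · exact ⟨q, q.lt_succ_self, h⟩
      · exact ⟨i, hi.trans q.lt_succ_self, h⟩

theorem forestTransduction_apply (q : ℕ) :
    (forestTransduction q).apply M =
      (roundsTransduction q).apply (M.withArcs fun _ _ => False) := by
  have : Struc.ofRel M.univ (fun R x => (initialFormulas R).Holds M x Fin.elim0) =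
      M.withArcs fun _ _ => False := by
    refine Struc.ext_rel rfl (Fin.cases (fun s => ?_) (fun R s => ?_))
    · exact Iff.rfl
    · exact ⟨fun h => h.2, fun h => ⟨M.rel_mem R _ h, h⟩⟩
  rw [← this]
  simp only [forestTransduction, Transduction.apply, Elementary.apply, Set.mem_singleton_iff,
    Set.iUnion_iUnion_eq_left]

end apply

/-! ## Size and computability -/

theorem forestTransduction_size_le :
    ∃ c : ℕ, ∀ q : ℕ, 0 < q → (forestTransduction q).size ≤ c * q := by
  have key : ∃ c d : ℕ, ∀ q, (roundsTransduction q).size = c * q + d := by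
    refine ⟨1 + 1 + 1 + roundInterpretation.size, (roundsTransduction 0).size, fun q => ?_⟩
    induction q with
    | zero => simp
    | succ q ih =>
      have : (roundsTransduction (q + 1)).size =
        1 + (1 + (1 + (roundInterpretation.size + (roundsTransduction q).size))) := rfl
      rw [this, ih]
      ring
  obtain ⟨c, d, h⟩ := key
  have key' : ∃ e : ℕ, ∀ q, (forestTransduction q).size = e + (roundsTransduction q).size :=
    ⟨_, fun _ => rfl⟩
  obtain ⟨e, h'⟩ := key'
  -- The size is affine in `q`; the constant part is absorbed because `q ≥ 1`.
  refine ⟨c + d + e, fun q hq => ?_⟩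
  rw [h', h]
  nlinarith

/-- Each round prepends the same word `w`, so the code arises by primitive recursion from constant
words, and the formulas themselves need not be computed. -/
theorem forestTransduction_code_computable :
    Computable fun q => (forestTransduction q).code := by
  have key : ∃ w : List ℕ, ∀ q,
      (roundsTransduction (q + 1)).code = w ++ (roundsTransduction q).code := by
    refine ⟨1 :: 0 :: 1 :: 0 :: 1 :: 0 :: 1 :: roundInterpretation.code, fun q => ?_⟩
    rw [roundsTransduction]
    simp [Transduction.code, Elementary.code]
  obtain ⟨w, hw⟩ := key
  have key' : ∃ w' : List ℕ, ∀ q, (forestTransduction q).code = w' ++ (roundsTransduction q).code :=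
    ⟨_ :: _, fun _ => rfl⟩
  obtain ⟨w', hw'⟩ := key'
  have h : Primrec fun q => (roundsTransduction q).code := by
    refine (Primrec.nat_rec₁ (f := fun _ l => w ++ l) (roundsTransduction 0).code
      (Primrec.list_append.comp (Primrec.const w) Primrec.snd)).of_eq fun q => ?_
    induction q with
    | zero => rfl
    | succ q ih => rw [hw, ← ih]
  exact ((Primrec.list_append.comp (Primrec.const w') h).of_eq fun q => (hw' q).symm).to_comp

/-! ## The final sentence defines elimination forests -/

theorem DirGraph.IsRootedForest.exists_minimal {α : Type u} {D : DirGraph α}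
    (hD : D.IsRootedForest) {X : Set α} (hX : X.Nonempty) :
    ∃ x ∈ X, ∀ y ∈ X, ¬ TransGen D.arc y x := by
  -- Only the vertices are finite in number; an element of `X` outside them is the end of no arc.
  by_cases hv : (X ∩ D.verts).Nonempty
  · have : Finite D.verts := hD.finite
    have : Std.Irrefl (fun x y : D.verts => TransGen D.arc x y) := ⟨fun x => hD.acyclic x⟩
    have : IsTrans D.verts (fun x y => TransGen D.arc x y) := ⟨fun _ _ _ => TransGen.trans⟩
    obtain ⟨x, hxX, hx⟩ := hv
    obtain ⟨m, hm, hmin⟩ := (Finite.wellFounded_of_trans_of_irrefl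
      (fun x y : D.verts => TransGen D.arc x y)).has_min {x | x.1 ∈ X} ⟨⟨x, hx⟩, hxX⟩
    refine ⟨m, hm, fun y hy h => hmin ⟨y, ?_⟩ hy h⟩
    obtain ⟨z, hyz, -⟩ := TransGen.head'_iff.mp h
    exact (hD.arc_mem _ _ hyz).1
  · obtain ⟨x, hx⟩ := hX
    refine ⟨x, hx, fun y _ h => hv ⟨x, hx, ?_⟩⟩
    obtain ⟨z, -, hzx⟩ := TransGen.tail'_iff.mp h
    exact (hD.arc_mem _ _ hzx).2

theorem holds_forestSentence_iff {α : Type u} (M : Struc sigEF α) (hM : M.IsIncidence)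
    (hfin : {x | M.Vertex x}.Finite) (s : Fin 0 → α) (S : Fin 0 → Set α) :
    forestSentence.Holds M s S ↔ M.forest.IsEliminationForest M.hypergraph := by
  rw [holds_forestSentence]
  constructor
  · rintro ⟨h₁, h₂, h₃, h₄⟩
    refine ⟨⟨hfin, fun x y h => h₁ x (Struc.child_mem h).1 y (Struc.child_mem h).2 h,
      fun x y z hx hy => h₂ x (Struc.child_mem hx).1 y (Struc.child_mem hy).1 z
        (Struc.child_mem hx).2 ⟨hx, hy⟩, fun x hx => ?_⟩, rfl, ?_⟩
    -- The test set consists of all elements on closed directed walks through `x`: each of them has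
    -- a predecessor in the set.
    · obtain ⟨m, -, ⟨-, hxm, hmx⟩, hmin⟩ := h₃
        {m | m ∈ M.univ ∧ TransGen M.Child x m ∧ TransGen M.Child m x} (fun _ h => h.1) (by
          obtain ⟨y, hy, -⟩ := TransGen.head'_iff.mp hx
          have hxu := (Struc.child_mem hy).1
          exact ⟨x, hxu, hxu, hx, hx⟩)
      obtain ⟨p, hxp, hpm⟩ := TransGen.tail'_iff.mp hxm
      have hpu := (Struc.child_mem hpm).1
      refine hmin p hpu ⟨hpu, ?_, hmx.head hpm⟩ hpm
      exact (TransGen.trans_left hx hxp)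
    · rintro _ ⟨e, -, rfl⟩ x ⟨-, hx⟩ y ⟨-, hy⟩
      exact h₄ e (Struc.adjacent_mem hx).2 x (Struc.adjacent_mem hx).1 y
        (Struc.adjacent_mem hy).1 ⟨hx, hy⟩
  · rintro ⟨h, -, h'⟩
    refine ⟨fun x _ y _ hxy => h.arc_mem _ _ hxy,
      fun x _ y _ z _ hz => h.parent_unique _ _ _ hz.1 hz.2, ?_, ?_⟩
    · rintro X hX ⟨x, -, hx⟩
      obtain ⟨m, hm, hmin⟩ := h.exists_minimal ⟨x, hx⟩
      exact ⟨m, hX hm, hm, fun y _ hy hym => hmin y hy (.single hym)⟩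
    · rintro e - x - y - ⟨hx, hy⟩
      exact h' _ ⟨e, (hM.adjacent_mem _ _ hx).2, rfl⟩ x ⟨(hM.adjacent_mem _ _ hx).1, hx⟩ y
        ⟨(hM.adjacent_mem _ _ hy).1, hy⟩

theorem DirGraph.IsEliminationForest.image {α : Type u} {β : Type v} {F : DirGraph α}
    {H : Hypergraph α} (hF : F.IsEliminationForest H) {f : α → β} (hf : f.Injective) :
    (F.image f).IsEliminationForest (H.image f) := by
  obtain ⟨hF₁, hF₂, hF₃⟩ := hF
  refine ⟨⟨hF₁.finite.image f, ?_, ?_, ?_⟩, congrArg (f '' ·) hF₂, ?_⟩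
  · rintro _ _ ⟨a, b, hab, rfl, rfl⟩
    exact ⟨⟨a, (hF₁.arc_mem _ _ hab).1, rfl⟩, ⟨b, (hF₁.arc_mem _ _ hab).2, rfl⟩⟩
  · rintro _ _ _ ⟨a, b, hab, rfl, rfl⟩ ⟨c, d, hcd, rfl, hdb⟩
    rw [hf hdb] at hcd
    rw [hF₁.parent_unique _ _ _ hab hcd]
  · intro x hx
    -- Injectivity of `f` makes consecutive arcs of the image come from consecutive arcs of `F`.
    have key : ∀ y, TransGen (F.image f).arc x y → ∃ a b, TransGen F.arc a b ∧ f a = x ∧ f b = y := by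
      intro y hy
      induction hy with
      | single h =>
        obtain ⟨a, b, hab, ha, hb⟩ := h
        exact ⟨a, b, .single hab, ha, hb⟩
      | tail _ h ih =>
        obtain ⟨a, b, hab, ha, hb⟩ := ih
        obtain ⟨c, d, hcd, hc, hd⟩ := h
        rw [← hb] at hc
        rw [hf hc] at hcd
        exact ⟨a, d, hab.tail hcd, ha, hd⟩
    obtain ⟨a, b, hab, ha, hb⟩ := key x hx
    rw [← ha] at hb
    rw [hf hb] at hab
    exact hF₁.acyclic a hab
  · rintro _ ⟨e, he, rfl⟩ _ ⟨x, hx, rfl⟩ _ ⟨y, hy, rfl⟩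
    have lift : ∀ a b, F.Ancestor a b → (F.image f).Ancestor (f a) (f b) := fun a b h =>
      ReflTransGen.lift f (fun a b hab => ⟨a, b, hab, rfl, rfl⟩) _ _ h
    exact (hF₃ e he x hx y hy).imp (lift _ _) (lift _ _)

/-! ## The structure of a tree decomposition -/

theorem vtx_injective {α : Type u} (N : Type v) : (vtx (α := α) N).Injective := by
  intro a b h
  simpa [vtx, base] using h

namespace TreeDecomposition

variable {α : Type u} {H : FinHypergraph α} {N : Type v} (t : TreeDecomposition H N)
  (C : Elt (Obj α N) → Elt (Obj α N) → Prop) {x y : Elt (Obj α N)}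

theorem toEF_vertex : (t.struc.toEF C).Vertex x ↔ ∃ w ∈ H.vertexSet, x = vtx N w := by
  constructor
  · rintro ⟨h, -, w, hw : x = _⟩
    obtain ⟨w', hw', h'⟩ | ⟨e, -, h'⟩ | ⟨n, h'⟩ := h (0 : Fin 1)
    · exact ⟨w', hw', h'⟩
    · exact absurd (hw.symm.trans h') (by simp [base])
    · exact absurd (hw.symm.trans h') (by simp [base])
  · rintro ⟨w, hw, rfl⟩
    have : ∀ i : Fin 1, (![vtx N w] : Fin 1 → Elt (Obj α N)) i ∈ t.struc.univ :=
      Fin.forall_fin_one.mpr (.inl ⟨w, hw, rfl⟩)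
    -- Membership is asked for twice because `toEF` and `struc` both restrict through `Struc.ofRel`.
    exact ⟨this, this, w, rfl⟩

theorem toEF_edge : (t.struc.toEF C).Edge x ↔ ∃ e ∈ H.edgeSet, x = base (.edge e) := by
  constructor
  · rintro ⟨h, -, e, he : x = _⟩
    obtain ⟨w', -, h'⟩ | ⟨e, he, h'⟩ | ⟨n, h'⟩ := h (0 : Fin 1)
    · exact absurd (he.symm.trans h') (by simp [base])
    · exact ⟨e, he, h'⟩
    · exact absurd (he.symm.trans h') (by simp [base])
  · rintro ⟨e, he, rfl⟩
    have : ∀ i : Fin 1, (![base (.edge e)] : Fin 1 → Elt (Obj α N)) i ∈ t.struc.univ :=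
      Fin.forall_fin_one.mpr (.inr <| .inl ⟨e, he, rfl⟩)
    exact ⟨this, this, e, rfl⟩

theorem toEF_adjacent : (t.struc.toEF C).Adjacent x y ↔
    ∃ e ∈ H.edgeSet, ∃ w ∈ e, x = vtx N w ∧ y = base (.edge e) := by
  constructor
  · rintro ⟨h, -, w, e, hw : x = _, he : y = _, hwe⟩
    obtain ⟨w', -, h'⟩ | ⟨e', he', h'⟩ | ⟨n, h'⟩ := h (1 : Fin 2)
    · exact absurd (he.symm.trans h') (by simp [base])
    · obtain rfl : e = e' := by simpa [base] using he.symm.trans h'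
      exact ⟨e, he', w, hwe, hw, he⟩
    · exact absurd (he.symm.trans h') (by simp [base])
  · rintro ⟨e, he, w, hw, rfl, rfl⟩
    have : ∀ i : Fin 2, (![vtx N w, base (.edge e)] : Fin 2 → Elt (Obj α N)) i ∈ t.struc.univ :=
      Fin.forall_fin_two.mpr
        ⟨.inl ⟨w, H.subset_vertexSet_of_mem_edgeSet' he hw, rfl⟩, .inr <| .inl ⟨e, he, rfl⟩⟩
    exact ⟨this, this, w, e, rfl, rfl, hw⟩

theorem toEF_child : (t.struc.toEF C).Child x y ↔ x ∈ t.struc.univ ∧ y ∈ t.struc.univ ∧ C x y := by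
  refine Iff.trans (b := (∀ i : Fin 2, (![x, y] : Fin 2 → _) i ∈ t.struc.univ) ∧ C x y)
    Iff.rfl ?_
  rw [Fin.forall_fin_two, and_assoc]
  exact Iff.rfl

theorem toEF_isIncidence : (t.struc.toEF C).IsIncidence where
  disjoint x hx he := by
    obtain ⟨w, -, h⟩ := (t.toEF_vertex C).mp hx
    obtain ⟨e, -, h'⟩ := (t.toEF_edge C).mp he
    exact absurd (h.symm.trans h') (by simp [vtx, base])
  adjacent_mem x y h := by
    obtain ⟨e, he, w, hw, hx, hy⟩ := (t.toEF_adjacent C).mp h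
    exact ⟨(t.toEF_vertex C).mpr ⟨w, H.subset_vertexSet_of_mem_edgeSet' he hw, hx⟩,
      (t.toEF_edge C).mpr ⟨e, he, hy⟩⟩
  edge_ext y z hy hz h := by
    obtain ⟨e, he, rfl⟩ := (t.toEF_edge C).mp hy
    obtain ⟨f, hf, rfl⟩ := (t.toEF_edge C).mp hz
    simp only [toEF_adjacent] at h
    congr 2
    ext w
    have := h (vtx N w)
    simp only [vtx, base, Prod.mk.injEq, Obj.vertex.injEq, Obj.edge.injEq, and_true] at this
    constructor
    · intro hw
      obtain ⟨_, -, _, h₁, rfl, rfl⟩ := this.mp ⟨e, he, w, hw, rfl, rfl⟩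
      exact h₁
    · intro hw
      obtain ⟨_, -, _, h₁, rfl, rfl⟩ := this.mpr ⟨f, hf, w, hw, rfl, rfl⟩
      exact h₁

theorem toEF_hypergraph : (t.struc.toEF C).hypergraph = H.toHypergraph.image (vtx N) := by
  have hadj : ∀ e ∈ H.edgeSet, {x | (t.struc.toEF C).Vertex x ∧
      (t.struc.toEF C).Adjacent x (base (.edge e))} = vtx N '' e := by
    intro e he
    ext x
    constructor
    · rintro ⟨-, h⟩
      obtain ⟨f, -, w, hw, rfl, hf⟩ := (t.toEF_adjacent C).mp h
      obtain rfl : e = f := by simpa [base] using hf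
      exact ⟨w, hw, rfl⟩
    · rintro ⟨w, hw, rfl⟩
      have := (t.toEF_adjacent C).mpr ⟨e, he, w, hw, rfl, rfl⟩
      exact ⟨((t.toEF_isIncidence C).adjacent_mem _ _ this).1, this⟩
  refine Hypergraph.ext ?_ ?_
  · ext x
    refine (t.toEF_vertex C).trans ?_
    simp only [Hypergraph.image, Set.mem_image, eq_comm]
  · ext X
    constructor
    · rintro ⟨y, hy, rfl⟩
      obtain ⟨e, he, rfl⟩ := (t.toEF_edge C).mp hy
      exact ⟨e, he, (hadj e he).symm⟩
    · rintro ⟨e, he, rfl⟩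
      exact ⟨_, (t.toEF_edge C).mpr ⟨e, he, rfl⟩, (hadj e he).symm⟩

theorem toEF_holds_forestSentence :
    forestSentence.Holds (t.struc.toEF C) Fin.elim0 Fin.elim0 ↔
      (t.struc.toEF C).forest.IsEliminationForest (H.toHypergraph.image (vtx N)) := by
  rw [holds_forestSentence_iff _ (t.toEF_isIncidence C), toEF_hypergraph]
  refine (H.finite_vertexSet.image (vtx N)).subset fun x hx => ?_
  obtain ⟨w, hw, rfl⟩ := (t.toEF_vertex C).mp hx
  exact ⟨w, hw, rfl⟩

theorem toEF_forest {F : DirGraph α} (hF : F.IsEliminationForest H.toHypergraph) :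
    (t.struc.toEF (F.image (vtx N)).arc).forest = F.image (vtx N) := by
  refine DirGraph.ext ?_ ?_
  · ext x
    refine (t.toEF_vertex (F.image (vtx N)).arc).trans ?_
    rw [← hF.2.1]
    simp only [DirGraph.image, Set.mem_image, eq_comm]
  · funext x y
    refine propext ((t.toEF_child _).trans ⟨fun h => h.2.2, ?_⟩)
    rintro ⟨a, b, hab, rfl, rfl⟩
    obtain ⟨ha, hb⟩ := hF.1.arc_mem _ _ hab
    rw [hF.2.1] at ha hb
    exact ⟨.inl ⟨a, ha, rfl⟩, .inl ⟨b, hb, rfl⟩, a, b, hab, rfl, rfl⟩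

theorem struc_bag : t.struc.Bag x y ↔ ∃ w n, x = vtx N w ∧ y = base (.node n) ∧ w ∈ t.bag n := by
  constructor
  · rintro ⟨-, h⟩
    exact h
  · rintro ⟨w, n, rfl, rfl, h⟩
    refine ⟨Fin.forall_fin_two.mpr ⟨.inl ⟨w, t.bag_subset n h, rfl⟩, .inr <| .inr ⟨n, rfl⟩⟩,
      w, n, rfl, rfl, h⟩

theorem struc_descendant {m n : N} :
    t.struc.Descendant (base (.node m)) (base (.node n)) ↔ t.tree.Ancestor m n := by
  constructor
  · rintro ⟨-, m', n', h, h', hmn⟩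
    obtain rfl : m = m' := by simpa [base] using h
    obtain rfl : n = n' := by simpa [base] using h'
    exact hmn
  · intro h
    exact ⟨Fin.forall_fin_two.mpr ⟨.inr <| .inr ⟨m, rfl⟩, .inr <| .inr ⟨n, rfl⟩⟩,
      m, n, rfl, rfl, h⟩

theorem node_mem_univ (n : N) : base (.node n) ∈ t.struc.univ := .inr <| .inr ⟨n, rfl⟩

theorem exists_node_of_descendant (h : t.struc.Descendant x y) :
    (∃ m, x = base (.node m)) ∧ ∃ n, y = base (.node n) := by
  obtain ⟨-, m, n, hm, hn, -⟩ := h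
  exact ⟨⟨m, hm⟩, ⟨n, hn⟩⟩

/-! ## Margin nodes and the tree -/

theorem mem_bag_marginNode (w : H.vertexSet) : w.1 ∈ t.bag (t.marginNode w) :=
  (t.existsUnique_margin w.2).choose_spec.1.1

theorem ancestor_antisymm {m n : N} (h : t.tree.Ancestor m n) (h' : t.tree.Ancestor n m) :
    m = n := by
  obtain h | h := reflTransGen_iff_eq_or_transGen.mp h
  · exact h.symm
  · exact absurd (h.trans_left h') (t.isRootedTree.1.acyclic _)

/-- Walk from the margin node inside the connected set of nodes whose bags contain `w`. A step up
stays below the margin node unless it starts there, and then the parent's bag would contain `w`,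
contrary to the margin. -/
theorem ancestor_marginNode {w : H.vertexSet} {n : N} (hn : w.1 ∈ t.bag n) :
    t.tree.Ancestor (t.marginNode w) n := by
  have hm := (t.existsUnique_margin w.2).choose_spec.1
  have hr := (t.bags_connected w w.2).preconnected ⟨t.marginNode w, hm.1⟩ ⟨n, hn⟩
  rw [SimpleGraph.reachable_iff_reflTransGen] at hr
  suffices ∀ b : {n | w.1 ∈ t.bag n}, ReflTransGen
      (t.tree.graph.induce {n | w.1 ∈ t.bag n}).Adj ⟨t.marginNode w, hm.1⟩ b →
      t.tree.Ancestor (t.marginNode w) b from this ⟨n, hn⟩ hr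
  intro b hb
  induction hb with
  | refl => exact .refl
  | @tail b c _ hbc ih =>
    have hadj : t.tree.graph.Adj b c := hbc
    rw [DirGraph.graph, SimpleGraph.fromRel_adj] at hadj
    rcases hadj.2 with h | h
    · exact ih.tail h
    · rcases ReflTransGen.cases_tail ih with h0 | ⟨d, hxd, hdb⟩
      · rw [h0] at h
        exact absurd ⟨hm.1, c, h, c.2⟩ hm.2
      · rw [t.isRootedTree.1.parent_unique _ _ _ h hdb]
        exact hxd

theorem isMargin_iff {w : H.vertexSet} :
    t.struc.IsMargin (vtx N w.1) x ↔ x = base (.node (t.marginNode w)) := by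
  have hbag : ∀ n, t.struc.Bag (vtx N w.1) (base (.node n)) ↔ w.1 ∈ t.bag n := fun n => by
    rw [struc_bag]
    simp [vtx, base]
  constructor
  · rintro ⟨h, h'⟩
    obtain ⟨-, n, -, rfl, -⟩ := t.struc_bag.mp h
    have := h' _ (t.node_mem_univ _) ((hbag _).mpr (t.mem_bag_marginNode w))
    rw [t.ancestor_antisymm (t.struc_descendant.mp this) (t.ancestor_marginNode ((hbag n).mp h))]
  · rintro rfl
    refine ⟨(hbag _).mpr (t.mem_bag_marginNode w), fun n _ hn => ?_⟩
    obtain ⟨-, n, -, rfl, -⟩ := t.struc_bag.mp hn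
    exact t.struc_descendant.mpr (t.ancestor_marginNode ((hbag n).mp hn))

/-- The unique root is a common ancestor, and finiteness yields a deepest one. -/
theorem exists_lowest_common_ancestor (a b : N) : ∃ p, t.tree.Ancestor p a ∧ t.tree.Ancestor p b ∧
    ∀ z, t.tree.Ancestor p z → t.tree.Ancestor z a → t.tree.Ancestor z b → z = p := by
  have hf := t.isRootedTree.1
  have root : ∀ a, ∃ r, t.tree.IsRoot r ∧ t.tree.Ancestor r a := by
    intro a
    obtain ⟨r, hr, hmin⟩ := hf.exists_minimal (X := {r | t.tree.Ancestor r a}) ⟨a, .refl⟩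
    exact ⟨r, ⟨t.verts_eq ▸ Set.mem_univ r, fun p hp => hmin p (ReflTransGen.head hp hr)
      (.single hp)⟩, hr⟩
  obtain ⟨r, hr, hra⟩ := root a
  obtain ⟨r', hr', hrb⟩ := root b
  rw [t.isRootedTree.2.unique hr' hr] at hrb
  have : Finite N := Set.finite_univ_iff.mp (t.verts_eq ▸ hf.finite)
  have : Std.Irrefl (flip (TransGen t.tree.arc)) := ⟨hf.acyclic⟩
  have : IsTrans N (flip (TransGen t.tree.arc)) := ⟨fun _ _ _ h h' => h'.trans h⟩
  obtain ⟨p, ⟨hpa, hpb⟩, hmin⟩ := (Finite.wellFounded_of_trans_of_irrefl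
    (flip (TransGen t.tree.arc))).has_min {p | t.tree.Ancestor p a ∧ t.tree.Ancestor p b}
      ⟨r, hra, hrb⟩
  refine ⟨p, hpa, hpb, fun z hpz hza hzb => ?_⟩
  obtain h | h := reflTransGen_iff_eq_or_transGen.mp hpz
  · exact h
  · exact absurd h (hmin z ⟨hza, hzb⟩)

theorem reachable_of_ancestor {a b : N} (h : t.tree.Ancestor a b) : t.tree.graph.Reachable a b := by
  induction h with
  | refl => exact .refl _
  | tail _ hbc ih =>
    refine ih.trans (SimpleGraph.Adj.reachable ?_)
    rw [DirGraph.graph, SimpleGraph.fromRel_adj]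
    exact ⟨fun h => t.isRootedTree.1.acyclic _ (.single (h ▸ hbc)), .inl hbc⟩

/-- Existence suffices for handling stains; uniqueness of tree paths is never needed. -/
theorem exists_isPath (a b : N) : ∃ p : t.tree.graph.Walk a b, p.IsPath := by
  obtain ⟨c, hca, hcb, -⟩ := t.exists_lowest_common_ancestor a b
  exact ((t.reachable_of_ancestor hca).symm.trans (t.reachable_of_ancestor hcb)).exists_isPath

theorem right_mem_path (a b : N) : b ∈ t.tree.path a b := by
  obtain ⟨p, hp⟩ := t.exists_isPath a b
  exact ⟨p, hp, p.end_mem_support⟩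

/-- A walk that leaves the set of descendants of `z` contains `z` and its parent. -/
theorem mem_support_of_ancestor_of_not_ancestor {a b z : N} (p : t.tree.graph.Walk a b)
    (ha : t.tree.Ancestor z a) (hb : ¬ t.tree.Ancestor z b) :
    z ∈ p.support ∧ ∃ r ∈ p.support, t.tree.arc r z := by
  induction p with
  | nil => exact absurd ha hb
  | @cons a c b hac p ih =>
    by_cases hc : t.tree.Ancestor z c
    · obtain ⟨hz, r, hr, hrz⟩ := ih hc hb
      exact ⟨List.mem_cons_of_mem _ hz, r, List.mem_cons_of_mem _ hr, hrz⟩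
    -- The step from `a` to `c` leaves the subtree of `z`, so it goes up, and it must start at `z`
    -- itself.
    · have hadj := hac
      rw [DirGraph.graph, SimpleGraph.fromRel_adj] at hadj
      obtain h | h := hadj.2
      · exact absurd (ha.tail h) hc
      · obtain rfl | ⟨d, hzd, hda⟩ := ReflTransGen.cases_tail ha
        · exact ⟨List.mem_cons_self, c, List.mem_cons_of_mem _ p.start_mem_support, h⟩
        · exact absurd (t.isRootedTree.1.parent_unique _ _ _ h hda ▸ hzd) hc

/-! ## Stains and rounds -/

variable (F : DirGraph α) (K : Set H.vertexSet)

/-- The set of vertices `K` in the structure of `t`. -/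
def parentSet : Set (Elt (Obj α N)) := {x | ∃ w ∈ K, x = vtx N w.1}

/-- The vertices with a parent in `K`. -/
def childSet : Set (Elt (Obj α N)) :=
  {x | ∃ w ∈ K, ∃ v : H.vertexSet, F.arc w v ∧ x = vtx N v.1}

/-- The nodes that are joined to their parents by the stain of a vertex in `K`. -/
def joinedNodes : Set N := {n | ∃ w ∈ K, n ∈ t.stain F w ∧ ∃ p ∈ t.stain F w, t.tree.arc p n}

/-- The set of nodes `joinedNodes` in the structure of `t`. -/
def joinedSet : Set (Elt (Obj α N)) := {x | ∃ n ∈ t.joinedNodes F K, x = base (.node n)}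

variable {F K}

/-- Take for `p` the lowest common ancestor of the margin nodes. The subtree of a node `z` strictly
below `p` on either branch contains exactly one of the two margin nodes, so a path between them
passes through `z` and its parent; both are in the stain of `u`. -/
theorem roundArc_of_arc {u v : H.vertexSet} (hu : u ∈ K) (huv : F.arc u v) :
    t.struc.RoundArc (parentSet K) (childSet F K) (t.joinedSet F K)
      (vtx N u.1) (vtx N v.1) := by
  obtain ⟨p, hpa, hpb, hp⟩ := t.exists_lowest_common_ancestor (t.marginNode u) (t.marginNode v)
  refine ⟨⟨u, hu, rfl⟩, ⟨u, hu, v, huv, rfl⟩, _, t.node_mem_univ _, _, t.node_mem_univ _, _,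
    t.node_mem_univ p, t.isMargin_iff.mpr rfl, t.isMargin_iff.mpr rfl,
    t.struc_descendant.mpr hpa, t.struc_descendant.mpr hpb, ?_⟩
  rintro z - ⟨hpz, hz⟩
  obtain ⟨-, z, rfl⟩ := t.exists_node_of_descendant hpz
  simp only [struc_descendant] at hpz hz
  by_cases hzp : z = p
  · exact .inl (hzp ▸ rfl)
  refine .inr ⟨z, ⟨u, hu, ?_⟩, rfl⟩
  obtain ⟨π, hπ⟩ := t.exists_isPath (t.marginNode u) (t.marginNode v)
  have hsub : ∀ n ∈ π.support, n ∈ t.stain F u := fun n hn => .inr ⟨v, huv, π, hπ, hn⟩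
  suffices z ∈ π.support ∧ ∃ r ∈ π.support, t.tree.arc r z by
    obtain ⟨h, r, hr, hrz⟩ := this
    exact ⟨hsub _ h, r, hsub _ hr, hrz⟩
  obtain hz | hz := hz
  · exact t.mem_support_of_ancestor_of_not_ancestor π hz fun h => hzp (hp z hpz hz h)
  · simpa using t.mem_support_of_ancestor_of_not_ancestor π.reverse hz fun h =>
      hzp (hp z hpz h hz)

/-- Climb from `a` to `p`. Each node below `p` is joined to its parent by the stain of some `w ∈ K`;
this stain meets that of `u` in the node, so `w = u` and the parent is in the stain of `u` too. -/
theorem mem_stain_of_ancestor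
    (hK : ∀ u ∈ K, ∀ v ∈ K, (t.stain F u ∩ t.stain F v).Nonempty → u = v)
    {u : H.vertexSet} (hu : u ∈ K) {a p : N} (ha : a ∈ t.stain F u) (hpa : t.tree.Ancestor p a)
    (h : ∀ z, t.tree.Ancestor p z → t.tree.Ancestor z a → z = p ∨ z ∈ t.joinedNodes F K) :
    p ∈ t.stain F u := by
  induction hpa using ReflTransGen.head_induction_on with
  | refl => exact ha
  | @head p c hpc hca ih =>
    have hc : c ∈ t.stain F u := by
      -- A descendant `z` of the child `c` of `p` cannot be `p`, so it is joined to its parent.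
      refine ih fun z hcz hza => .inr ((h z (ReflTransGen.head hpc hcz) hza).resolve_left ?_)
      rintro rfl
      exact t.isRootedTree.1.acyclic _ (TransGen.head' hpc hcz)
    obtain rfl | ⟨w, hw, hcw, r, hr, hrc⟩ := h c (.single hpc) hca
    · exact hc
    · rw [hK u hu w hw ⟨c, hc, hcw⟩, t.isRootedTree.1.parent_unique _ _ _ hpc hrc]
      exact hr

/-- Being in `childSet`, `v` has a parent `w ∈ K`, and its margin node is in the stain of `w`.
Climbing from both margin nodes puts `p` into the stains of `u` and `w`, hence `u = w`. -/
theorem arc_of_roundArc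
    (hK : ∀ u ∈ K, ∀ v ∈ K, (t.stain F u ∩ t.stain F v).Nonempty → u = v)
    (h : t.struc.RoundArc (parentSet K) (childSet F K) (t.joinedSet F K) x y) :
    (F.image (vtx N)).arc x y := by
  obtain ⟨⟨u, hu, rfl⟩, ⟨w, hw, v, hwv, rfl⟩, _, -, _, -, _, -, ha, hb, hpa, hpb, h⟩ := h
  obtain rfl := t.isMargin_iff.mp ha
  obtain rfl := t.isMargin_iff.mp hb
  obtain ⟨⟨p, rfl⟩, -⟩ := t.exists_node_of_descendant hpa
  have h' : ∀ z, t.tree.Ancestor p z → t.tree.Ancestor z (t.marginNode u) ∨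
      t.tree.Ancestor z (t.marginNode v) → z = p ∨ z ∈ t.joinedNodes F K := by
    intro z hpz hz
    have := h _ (t.node_mem_univ z) (by simpa only [struc_descendant] using ⟨hpz, hz⟩)
    obtain h | ⟨z', hz', h⟩ := this
    · exact .inl (by simpa [base] using h)
    · obtain rfl : z = z' := by simpa [base] using h
      exact .inr hz'
  have h₁ := t.mem_stain_of_ancestor hK hu (.inl rfl) (t.struc_descendant.mp hpa)
    fun z hz hza => h' z hz (.inl hza)
  have h₂ := t.mem_stain_of_ancestor hK hw (.inr ⟨v, hwv, t.right_mem_path _ _⟩)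
    (t.struc_descendant.mp hpb) fun z hz hzb => h' z hz (.inr hzb)
  obtain rfl := hK u hu w hw ⟨p, h₁, h₂⟩
  exact ⟨u, v, hwv, rfl, rfl⟩

theorem toEF_mem_forestTransduction {F : DirGraph α} (hF : F.IsEliminationForest H.toHypergraph)
    {q : ℕ} (hq : (t.conflictGraph F).chromaticNumber ≤ q) :
    t.struc.toEF (F.image (vtx N)).arc ∈ (forestTransduction q).apply t.struc := by
  obtain ⟨c⟩ := SimpleGraph.chromaticNumber_le_iff_colorable.mp hq
  have hc : ∀ i : ℕ, ∀ u ∈ {w | (c w).val = i}, ∀ v ∈ {w | (c w).val = i},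
      (t.stain F u ∩ t.stain F v).Nonempty → u = v := by
    intro i u hu v hv h
    by_contra huv
    exact c.valid (v := u) (w := v) ⟨huv, h⟩ (Fin.ext (hu.trans hv.symm))
  rw [forestTransduction_apply]
  refine mem_roundsTransduction _ q _ (fun i => parentSet {w | (c w).val = i})
    (fun i => childSet F {w | (c w).val = i}) (fun i => t.joinedSet F {w | (c w).val = i})
    ?_ ?_ ?_ _ (fun x y => ⟨?_, ?_⟩) ?_
  · rintro i _ ⟨w, -, rfl⟩
    exact .inl ⟨w, w.2, rfl⟩
  · rintro i _ ⟨-, -, w, -, rfl⟩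
    exact .inl ⟨w, w.2, rfl⟩
  · rintro i _ ⟨n, -, rfl⟩
    exact t.node_mem_univ n
  · rintro ⟨u, v, huv, rfl, rfl⟩
    obtain ⟨hu, hv⟩ := hF.1.arc_mem _ _ huv
    rw [hF.2.1] at hu hv
    -- The arc is found in the round of the colour of its parent `u`.
    exact .inr ⟨_, (c ⟨u, hu⟩).2, t.roundArc_of_arc (u := ⟨u, hu⟩) (v := ⟨v, hv⟩) rfl huv⟩
  · rintro (h | ⟨i, -, h⟩)
    · exact h.elim
    · exact t.arc_of_roundArc (hc i) h
  · rw [toEF_holds_forestSentence, toEF_forest t hF]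
    exact hF.image (vtx_injective N)

end TreeDecomposition

end TDToForest

theorem mainTheorem6 :
    ∃ Tr : ℕ → TDToForest.Transduction TDToForest.sigTD TDToForest.sigEF,
      Computable (fun q => (Tr q).code) ∧
      (∃ c : ℕ, ∀ q : ℕ, 0 < q → (Tr q).size ≤ c * q) ∧
      ∀ q : ℕ, 0 < q →
        ∀ (α : Type u) (N : Type v) (H : TDToForest.FinHypergraph α)
          (t : TDToForest.TreeDecomposition H N),
          (∀ M ∈ (Tr q).apply t.struc,
            M.IsIncidence ∧
            M.hypergraph = H.toHypergraph.image (TDToForest.vtx N) ∧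
            M.forest.IsEliminationForest (H.toHypergraph.image (TDToForest.vtx N))) ∧
          ∀ F : TDToForest.DirGraph α, F.IsEliminationForest H.toHypergraph →
            (t.conflictGraph F).chromaticNumber ≤ (q : ℕ∞) →
              ∃ M ∈ (Tr q).apply t.struc, M.forest = F.image (TDToForest.vtx N) := by
  refine ⟨TDToForest.forestTransduction, TDToForest.forestTransduction_code_computable,
    TDToForest.forestTransduction_size_le, fun q _ α N H t => ⟨fun M hM => ?_, fun F hF hq =>
      ⟨_, t.toEF_mem_forestTransduction hF hq, t.toEF_forest hF⟩⟩⟩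
  rw [TDToForest.forestTransduction_apply] at hM
  obtain ⟨C, rfl, h⟩ := TDToForest.exists_of_mem_roundsTransduction _ q _ M hM
  exact ⟨t.toEF_isIncidence C, t.toEF_hypergraph C, (t.toEF_holds_forestSentence C).mp h⟩
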